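/- Let $\mathcal L_0=\{\wedge,\vee,\otimes,\to,1\}$ be the language of commutative integral residuated lattices (arities $2,2,2,2,0$), let $Fm$ be the set of $\mathcal L_0$-formulas over countably infinitely many variables, and let $\Gamma,\Delta$ range over finite multisets of formulas and $\varphi$ over formulas. *Semantics.* Every MV-algebra $\langle A,\oplus,\neg,0\rangle$ is regarded as an $\mathcal L_0$-algebra through $1=\neg 0$, $x\otimes y=\neg(\neg x\oplus\neg y)$, $x\to y=\neg x\oplus y$, $x\vee y=\neg(\neg x\oplus y)\oplus y$, $x\wedge y=\neg(\neg x\vee\neg y)$, with $x\le y$ iff $x\wedge y=x$. The multiset companion of Łukasiewicz logic is the relation $$[\varphi_1,\dots,\varphi_n]\vdash_{\mathcal{MV}}[\psi_1,\dots,\psi_m]\iff \varphi_1\otimes\dots\otimes\varphi_n\le\psi_1\otimes\dots\otimes\psi_m\ \text{ holds in every MV-algebra under every valuation,}$$ where the empty product is $1$. *Derivations.* Let $\mathsf{AS}$ be a set of consecutions $\Psi\rhd\Psi'$ (pairs of finite multisets of formulas) closed under substitutions. Then $\Gamma\vdash_{\mathsf{AS}}\Delta$ means that there is a finite sequence $\Gamma=\Gamma_1,\dots,\Gamma_k$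 ($k\ge1$) of finite multisets of formulas such that $\Delta\leqslant\Gamma_k$ (sub-multiset) and for every $1<j\le k$ there is $\Psi\rhd\Psi'\in\mathsf{AS}$ with $\Psi\leqslant\Gamma_{j-1}$ and $\Gamma_j=(\Gamma_{j-1}\setminus\Psi)\uplus\Psi'$. *The systems.* $\mathsf{MV}^s$ consists of the axioms $\emptyset\rhd[\alpha]$, for all instances $\alpha$ in $\mathcal L_0$ of the following axiom schemata of Łukasiewicz logic: - $\varphi\to(\psi\to\varphi)$, $\ (\varphi\to\psi)\to((\psi\to\chi)\to(\varphi\to\chi))$, - $((\varphi\to\psi)\to\psi)\to((\psi\to\varphi)\to\varphi)$, $\ ((\varphi\to\psi)\to(\psi\to\varphi))\to(\psi\to\varphi)$, - $((\varphi\otimes\psi)\to\chi)\to(\varphi\to(\psi\to\chi))$, $\ (\varphi\to(\psi\to\chi))\to((\varphi\otimes\psi)\to\chi)$, - $(\varphi\wedge\psi)\to\varphi$, $\ (\varphi\wedge\psi)\to\psi$, $\ (\chi\to\varphi)\to((\chi\to\psi)\to(\chi\to(\varphi\wedge\psi)))$, - $\varphi\to(\varphi\vee\psi)$, $\ \psi\to(\varphi\vee\psi)$,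 $\ (\varphi\to\chi)\to((\psi\to\chi)\to((\varphi\vee\psi)\to\chi))$, - $1$, together with all instances of modus ponens $[\varphi,\varphi\to\psi]\rhd[\psi]$. The system $\mathsf{MV}$ extends $\mathsf{MV}^s$ by all instances of $\otimes$-elimination $[\varphi\otimes\psi]\rhd[\varphi,\psi]$. **Theorem.** For all finite multisets $\Gamma,\Delta$ of formulas and every formula $\varphi$: 1. $\Gamma\vdash_{\mathsf{MV}^s}[\varphi]\iff\Gamma\vdash_{\mathcal{MV}}[\varphi]$; 2. $\Gamma\vdash_{\mathsf{MV}}\Delta\iff\Gamma\vdash_{\mathcal{MV}}\Delta$. -/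

import Mathlib

universe u

namespace MultisetLogic




/-- Formulas of the language `⟨∧, ∨, ⊗, →, 1⟩` of commutative integral residuated lattices
(arities `2, 2, 2, 2, 0`) over the variables `p₀, p₁, p₂, …`. -/
inductive Fm : Type
  | var : ℕ → Fm
  | conj : Fm → Fm → Fm
  | disj : Fm → Fm → Fm
  | tens : Fm → Fm → Fm
  | imp : Fm → Fm → Fm
  | one : Fm

namespace Fm

scoped infixl:75 " ⋏ " => Fm.conj
scoped infixl:72 " ⋎ " => Fm.disj
scoped infixl:77 " ⊙ " => Fm.tens
scoped infixr:70 " ⇒ " => Fm.imp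

/-- The endomorphism of the algebra of formulas that extends `s` (a substitution). -/
def subst (s : ℕ → Fm) : Fm → Fm
  | var n => s n
  | conj φ ψ => conj (subst s φ) (subst s ψ)
  | disj φ ψ => disj (subst s φ) (subst s ψ)
  | tens φ ψ => tens (subst s φ) (subst s ψ)
  | imp φ ψ => imp (subst s φ) (subst s ψ)
  | one => one

/-- The product `(⋯(φ₁ ⊗ φ₂) ⊗ ⋯) ⊗ φₙ` of a list of formulas; the empty product is `1`. -/
def bigTens : List Fm → Fm
  | [] => one
  | φ :: l => l.foldl tens φ

end Fm

open scoped Fm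



/-- A consecution `Γ ▷ Δ`: a pair of finite multisets of formulas. -/
abbrev Consecution : Type := Multiset Fm × Multiset Fm

/-- An axiomatic system: a set of consecutions closed under substitutions. -/
structure AxSystem : Type where
  rules : Set Consecution
  closed : ∀ (s : ℕ → Fm) (Γ Δ : Multiset Fm), (Γ, Δ) ∈ rules →
    (Γ.map (Fm.subst s), Δ.map (Fm.subst s)) ∈ rules

/-- One step of a derivation. For some `Ψ ▷ Ψ'` in the system, `Ψ ≤ Γ` and
`Γ' = (Γ ∖ Ψ) ⊎ Ψ'`; here `Θ` is the unchanged context `Γ ∖ Ψ`. -/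
def AxSystem.Step (S : AxSystem) (Γ Γ' : Multiset Fm) : Prop :=
  ∃ Ψ Ψ' Θ : Multiset Fm, (Ψ, Ψ') ∈ S.rules ∧ Γ = Θ + Ψ ∧ Γ' = Θ + Ψ'

/-- `Δ` is derivable from `Γ`: there is a finite sequence of multisets which starts with `Γ`,
each later member of which arises from its predecessor by one step, and whose last member
contains `Δ` as a sub-multiset. -/
def AxSystem.Derives (S : AxSystem) (Γ Δ : Multiset Fm) : Prop :=
  ∃ Γ' : Multiset Fm, Relation.ReflTransGen S.Step Γ Γ' ∧ Δ ≤ Γ'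



/-- The instances of the axiom schemata of Łukasiewicz logic in the language `⟨∧, ∨, ⊗, →, 1⟩`:
Łukasiewicz's axioms for implication, and the usual axioms for the other connectives. -/
inductive LukAx : Fm → Prop
  | weak (φ ψ : Fm) : LukAx (φ ⇒ ψ ⇒ φ)
  | suff (φ ψ χ : Fm) : LukAx ((φ ⇒ ψ) ⇒ (ψ ⇒ χ) ⇒ φ ⇒ χ)
  | waj (φ ψ : Fm) : LukAx (((φ ⇒ ψ) ⇒ ψ) ⇒ (ψ ⇒ φ) ⇒ φ)
  | lin (φ ψ : Fm) : LukAx (((φ ⇒ ψ) ⇒ ψ ⇒ φ) ⇒ ψ ⇒ φ)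
  | curry (φ ψ χ : Fm) : LukAx ((φ ⊙ ψ ⇒ χ) ⇒ φ ⇒ ψ ⇒ χ)
  | uncurry (φ ψ χ : Fm) : LukAx ((φ ⇒ ψ ⇒ χ) ⇒ φ ⊙ ψ ⇒ χ)
  | conj_left (φ ψ : Fm) : LukAx (φ ⋏ ψ ⇒ φ)
  | conj_right (φ ψ : Fm) : LukAx (φ ⋏ ψ ⇒ ψ)
  | conj_intro (φ ψ χ : Fm) : LukAx ((χ ⇒ φ) ⇒ (χ ⇒ ψ) ⇒ χ ⇒ φ ⋏ ψ)
  | disj_left (φ ψ : Fm) : LukAx (φ ⇒ φ ⋎ ψ)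
  | disj_right (φ ψ : Fm) : LukAx (ψ ⇒ φ ⋎ ψ)
  | disj_elim (φ ψ χ : Fm) : LukAx ((φ ⇒ χ) ⇒ (ψ ⇒ χ) ⇒ φ ⋎ ψ ⇒ χ)
  | one : LukAx Fm.one

theorem LukAx.subst (s : ℕ → Fm) {φ : Fm} (h : LukAx φ) : LukAx (φ.subst s) := by
  cases h <;> simp only [Fm.subst] <;> constructor

/-- The consecutions of `MVˢ`: the axioms, and modus ponens `[φ, φ → ψ] ▷ [ψ]`. -/
inductive MVsRule : Consecution → Prop
  | ax (φ : Fm) : LukAx φ → MVsRule (0, {φ})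
  | mp (φ ψ : Fm) : MVsRule ({φ, φ ⇒ ψ}, {ψ})

/-- The consecutions of `MV`: those of `MVˢ`, and `⊗`-elimination `[φ ⊗ ψ] ▷ [φ, ψ]`. -/
inductive MVRule : Consecution → Prop
  | base (c : Consecution) : MVsRule c → MVRule c
  | tens_elim (φ ψ : Fm) : MVRule ({φ ⊙ ψ}, {φ, ψ})

theorem MVsRule.subst (s : ℕ → Fm) {Γ Δ : Multiset Fm} (h : MVsRule (Γ, Δ)) :
    MVsRule (Γ.map (Fm.subst s), Δ.map (Fm.subst s)) := by
  cases h with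
  | ax φ h => simpa using MVsRule.ax _ (h.subst s)
  | mp φ ψ => simpa [Fm.subst] using MVsRule.mp (φ.subst s) (ψ.subst s)

theorem MVRule.subst (s : ℕ → Fm) {Γ Δ : Multiset Fm} (h : MVRule (Γ, Δ)) :
    MVRule (Γ.map (Fm.subst s), Δ.map (Fm.subst s)) := by
  cases h with
  | base _ h => exact .base _ (h.subst s)
  | tens_elim φ ψ => simpa [Fm.subst] using MVRule.tens_elim (φ.subst s) (ψ.subst s)

/-- The axiomatic system `MVˢ`. -/
def MVs : AxSystem where
  rules := {c | MVsRule c}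
  closed s _ _ h := MVsRule.subst s h

/-- The axiomatic system `MV`. -/
def MV : AxSystem where
  rules := {c | MVRule c}
  closed s _ _ h := MVRule.subst s h



/-- An MV-algebra `⟨A, ⊕, ¬, 0⟩`. -/
class MVAlgebra (A : Type u) where
  oplus : A → A → A
  neg : A → A
  zero : A
  oplus_assoc : ∀ x y z, oplus x (oplus y z) = oplus (oplus x y) z
  oplus_comm : ∀ x y, oplus x y = oplus y x
  oplus_zero : ∀ x, oplus x zero = x
  neg_neg : ∀ x, neg (neg x) = x
  oplus_neg_zero : ∀ x, oplus x (neg zero) = neg zero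
  lukasiewicz : ∀ x y, oplus (neg (oplus (neg x) y)) y = oplus (neg (oplus (neg y) x)) x

namespace MVAlgebra

variable {A : Type u} [MVAlgebra A]

/-- The constant `1 = ¬0`. -/
def one : A := neg zero

/-- The product `x ⊗ y = ¬(¬x ⊕ ¬y)`. -/
def tens (x y : A) : A := neg (oplus (neg x) (neg y))

/-- The residuum `x → y = ¬x ⊕ y`. -/
def imp (x y : A) : A := oplus (neg x) y

/-- The join `x ∨ y = ¬(¬x ⊕ y) ⊕ y`. -/
def sup (x y : A) : A := oplus (neg (oplus (neg x) y)) y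

/-- The meet `x ∧ y = ¬(¬x ∨ ¬y)`. -/
def inf (x y : A) : A := neg (sup (neg x) (neg y))

/-- The order of the lattice reduct: `x ≤ y` iff `x ∧ y = x`. -/
def le (x y : A) : Prop := inf x y = x

/-- The homomorphism from the algebra of formulas to `A` that extends the valuation `e`. -/
def eval (e : ℕ → A) : Fm → A
  | .var n => e n
  | .conj φ ψ => inf (eval e φ) (eval e ψ)
  | .disj φ ψ => sup (eval e φ) (eval e ψ)
  | .tens φ ψ => tens (eval e φ) (eval e ψ)
  | .imp φ ψ => imp (eval e φ) (eval e ψ)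
  | .one => one

end MVAlgebra

/-- The inequality `φ ≤ ψ` holds in all MV-algebras, under all valuations. -/
def MVValidLe (φ ψ : Fm) : Prop :=
  ∀ (A : Type u) [MVAlgebra A] (e : ℕ → A), MVAlgebra.le (MVAlgebra.eval e φ) (MVAlgebra.eval e ψ)

/-- The multiset companion of Łukasiewicz logic: `[φ₁, …, φₙ] ⊢ [ψ₁, …, ψₘ]` iff
`φ₁ ⊗ ⋯ ⊗ φₙ ≤ ψ₁ ⊗ ⋯ ⊗ ψₘ` holds in all MV-algebras, for all enumerations of the two multisets
(the value of a product does not depend on the enumeration). -/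
def MVCompanion (Γ Δ : Multiset Fm) : Prop :=
  ∀ l l' : List Fm, (l : Multiset Fm) = Γ → (l' : Multiset Fm) = Δ →
    MVValidLe.{u} (Fm.bigTens l) (Fm.bigTens l')

end MultisetLogic

namespace MultisetLogic

open scoped Fm

/-! Soundness: every rule can only raise the product of the values of the current multiset
(`MVRule.prod_Le`), and `⊗` is monotone and integral, so context and discarded formulas do no harm.
Completeness: without `0` the Lindenbaum algebra is only a commutative BCK-algebra with extra
operations, not an MV-algebra. But for each `a` in it the interval above `a` is an MV-algebra, with
`¬x = x → a`. Given `φ` and `ψ`, take for `a` the product of all their variable occurrences. It lies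
below every subformula (`mk_varProd_Le`), so the canonical valuation gives both formulas their own
classes (`val_eval_canonicalVal`), and validity of `φ ≤ ψ` makes `φ → ψ` a theorem. Theorems cost no
resources in a derivation. Currying one that starts from the product of the premises leaves one
modus ponens per premise, so each premise is spent exactly once. Several conclusions are reached by
deriving their product and splitting it with `⊗`-elimination. -/

/-! ### Commutative BCK-algebras -/

/-- Commutative BCK-algebras, in terms of the implication `x ⟶ y` and the top element `1`. -/
class CommBCK (H : Type u) where
  imp : H → H → H
  top : H
  top_imp : ∀ x, imp top x = x
  imp_top : ∀ x, imp x top = top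
  imp_self : ∀ x, imp x x = top
  exchange : ∀ x y z, imp x (imp y z) = imp y (imp x z)
  imp_imp_comm : ∀ x y, imp (imp x y) y = imp (imp y x) x

namespace CommBCK

variable {H : Type u} [CommBCK H] {x y z a : H}

/-- The natural order of a BCK-algebra. -/
def Le (x y : H) : Prop := imp x y = top

theorem Le.refl (x : H) : Le x x := imp_self x

theorem Le.top (x : H) : Le x top := imp_top x

theorem Le.antisymm (h : Le x y) (h' : Le y x) : x = y := by
  have := imp_imp_comm x y
  rw [Le] at h h'
  rwa [h, h', top_imp, top_imp, eq_comm] at this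

/-- Exchange brings out `(y → z) → z`; commutativity turns it into `(z → y) → y`, and exchanging
back leaves `(x → y) → ((z → y) → (x → y))`. -/
theorem imp_trans (x y z : H) : imp (imp x y) (imp (imp y z) (imp x z)) = top := by
  rw [exchange (imp y z) x z, imp_imp_comm y z, exchange x (imp z y) y,
    exchange (imp x y), imp_self, imp_top]

theorem Le.trans (h : Le x y) (h' : Le y z) : Le x z := by
  have := imp_trans x y z
  rw [Le] at h h'
  rwa [h, h', top_imp, top_imp] at this

theorem Le.imp_right (h : Le y z) (x : H) : Le (imp x y) (imp x z) := by
  have := imp_trans x y z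
  rw [Le] at h
  rwa [h, top_imp] at this

theorem Le.imp_left (h : Le x y) (z : H) : Le (imp y z) (imp x z) := by
  have := imp_trans x y z
  rw [Le] at h
  rwa [h, top_imp] at this

theorem le_imp (x y : H) : Le x (imp y x) := by
  rw [Le, exchange, imp_self, imp_top]

theorem le_imp_comm : Le x (imp y z) ↔ Le y (imp x z) := by
  rw [Le, Le, exchange]

theorem le_imp_imp_left (x y : H) : Le x (imp (imp x y) y) := le_imp_comm.1 (Le.refl _)

theorem le_imp_imp_right (x y : H) : Le y (imp (imp x y) y) := le_imp _ _

/-- `(x → y) → y` is the join of `x` and `y`: applying antitonicity twice to `x ≤ z` bounds it by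
`(z → y) → y = (y → z) → z = z`. -/
theorem imp_imp_le (hx : Le x z) (hy : Le y z) : Le (imp (imp x y) y) z := by
  have h := (hx.imp_left y).imp_left y
  rw [imp_imp_comm z y] at h
  rw [Le] at hy
  rwa [hy, top_imp] at h

theorem imp_imp_eq_of_le (h : Le a x) : imp (imp x a) a = x := by
  rw [imp_imp_comm, show imp a x = CommBCK.top from h, top_imp]

end CommBCK

/-! ### MV-algebras -/

namespace MVAlgebra

open CommBCK

variable {A : Type u} [MVAlgebra A]

theorem zero_oplus (x : A) : oplus zero x = x := by rw [oplus_comm, oplus_zero]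

instance instCommBCK : CommBCK A where
  imp := imp
  top := one
  top_imp x := by rw [imp, one, neg_neg, zero_oplus]
  imp_top x := oplus_neg_zero _
  imp_self x := by
    -- At `y = 1` the left side collapses to `1` and the right side to `¬x ⊕ x`.
    have h := lukasiewicz x (neg zero)
    rw [oplus_neg_zero, neg_neg, zero_oplus] at h
    exact h.symm
  exchange x y z := by
    simp only [imp]
    rw [oplus_assoc, oplus_comm (neg x), ← oplus_assoc]
  imp_imp_comm := lukasiewicz

theorem tens_imp (x y z : A) : imp (tens x y) z = imp x (imp y z) := by
  simp only [imp, tens]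
  rw [neg_neg, oplus_assoc]

theorem neg_imp_neg (x y : A) : imp (neg x) (neg y) = imp y x := by
  simp only [imp]
  rw [neg_neg, oplus_comm]

theorem tens_Le_iff {x y z : A} : Le (tens x y) z ↔ Le x (imp y z) := by
  show imp _ _ = one ↔ imp _ _ = one
  rw [tens_imp]

theorem Le_neg_iff {x y : A} : Le (neg x) (neg y) ↔ Le y x := by
  show imp _ _ = one ↔ imp _ _ = one
  rw [neg_imp_neg]

theorem Le_sup_left (x y : A) : Le x (sup x y) := le_imp_imp_left x y

theorem Le_sup_right (x y : A) : Le y (sup x y) := le_imp_imp_right x y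

theorem sup_Le {x y z : A} (hx : Le x z) (hy : Le y z) : Le (sup x y) z := imp_imp_le hx hy

theorem inf_Le_left (x y : A) : Le (inf x y) x := by
  rw [← neg_neg x, inf, Le_neg_iff, neg_neg]
  exact Le_sup_left _ _

theorem inf_Le_right (x y : A) : Le (inf x y) y := by
  rw [← neg_neg y, inf, Le_neg_iff, neg_neg]
  exact Le_sup_right _ _

theorem Le_inf {x y z : A} (hx : Le z x) (hy : Le z y) : Le z (inf x y) := by
  rw [← neg_neg z, inf, Le_neg_iff]
  exact sup_Le (Le_neg_iff.2 hx) (Le_neg_iff.2 hy)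

theorem le_iff_Le {x y : A} : le x y ↔ Le x y :=
  ⟨fun h => by rw [← show inf x y = x from h]; exact inf_Le_right x y,
    fun h => (inf_Le_left x y).antisymm (Le_inf (Le.refl x) h)⟩

theorem tens_comm (x y : A) : tens x y = tens y x := by rw [tens, oplus_comm, tens]

theorem tens_assoc (x y z : A) : tens (tens x y) z = tens x (tens y z) := by
  simp only [tens, neg_neg, oplus_assoc]

theorem one_tens (x : A) : tens one x = x := by
  rw [tens, one, neg_neg, zero_oplus, neg_neg]

theorem tens_one (x : A) : tens x one = x := by rw [tens_comm, one_tens]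

theorem tens_Le_tens_left {x y : A} (h : Le x y) (z : A) : Le (tens z x) (tens z y) := by
  rw [tens_comm, tens_Le_iff]
  refine h.trans (tens_Le_iff.1 ?_)
  rw [tens_comm]
  exact Le.refl _

theorem tens_Le_left (x y : A) : Le (tens x y) x := tens_Le_iff.2 (le_imp x y)

theorem tens_Le_right (x y : A) : Le (tens x y) y := tens_comm x y ▸ tens_Le_left y x

theorem imp_imp_sup (x y z : A) : imp (imp x z) (imp (imp y z) (imp (sup x y) z)) = one := by
  rw [← tens_imp]
  refine le_imp_comm.1 (sup_Le ?_ ?_)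
  · exact le_imp_comm.1 (tens_Le_left _ _)
  · exact le_imp_comm.1 (tens_Le_right _ _)

theorem imp_imp_inf (x y z : A) : imp (imp z x) (imp (imp z y) (imp z (inf x y))) = one := by
  rw [← tens_imp, ← tens_imp]
  refine Le_inf ?_ ?_
  · exact tens_Le_iff.2 (tens_Le_left _ _)
  · exact tens_Le_iff.2 (tens_Le_right _ _)

/-- The identity behind prelinearity. -/
theorem imp_imp_imp (x y : A) : imp (imp x y) (imp y x) = imp y x := by
  -- With `key` and contraposition, both implications get the common consequent `¬(x ∨ y)`. Exchange
  -- then exposes a double residual over it, which cancels because `¬(x ∨ y) ≤ ¬y`.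
  have key : ∀ u v : A, imp (sup u v) v = imp u v := fun u v =>
    ((Le_sup_left u v).imp_left v).antisymm (le_imp_imp_left (imp u v) v)
  have hsup : sup x y = sup y x := lukasiewicz x y
  have h1 : imp x y = imp (neg y) (neg (sup x y)) := by rw [neg_imp_neg, key]
  have h2 : imp y x = imp (neg x) (neg (sup x y)) := by rw [neg_imp_neg, hsup, key]
  calc imp (imp x y) (imp y x)
      = imp (imp (neg y) (neg (sup x y))) (imp (neg x) (neg (sup x y))) := by rw [← h1, ← h2]
    _ = imp (neg x) (imp (imp (neg y) (neg (sup x y))) (neg (sup x y))) :=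
        CommBCK.exchange _ _ _
    _ = imp (neg x) (neg y) := congrArg _ (imp_imp_eq_of_le (Le_neg_iff.2 (Le_sup_right x y)))
    _ = imp y x := neg_imp_neg x y

theorem eval_lukAx (e : ℕ → A) {φ : Fm} (h : LukAx φ) : eval e φ = one := by
  cases h with
  | weak φ ψ => exact le_imp _ _
  | suff φ ψ χ => exact imp_trans _ _ _
  | waj φ ψ => exact (congrArg (imp · _) (lukasiewicz _ _)).trans (CommBCK.imp_self _)
  | lin φ ψ => exact (congrArg (imp · _) (imp_imp_imp _ _)).trans (CommBCK.imp_self _)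
  | curry φ ψ χ => exact (congrArg (imp · _) (tens_imp _ _ _)).trans (CommBCK.imp_self _)
  | uncurry φ ψ χ => exact (congrArg (imp _) (tens_imp _ _ _)).trans (CommBCK.imp_self _)
  | conj_left φ ψ => exact inf_Le_left _ _
  | conj_right φ ψ => exact inf_Le_right _ _
  | conj_intro φ ψ χ => exact imp_imp_inf _ _ _
  | disj_left φ ψ => exact Le_sup_left _ _
  | disj_right φ ψ => exact Le_sup_right _ _
  | disj_elim φ ψ χ => exact imp_imp_sup _ _ _
  | one => rfl

/-- The commutative monoid `⟨A, ⊗, 1⟩`. -/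
@[reducible] def tensMonoid (A : Type u) [MVAlgebra A] : CommMonoid A where
  mul := tens
  one := one
  mul_assoc := tens_assoc
  one_mul := one_tens
  mul_one := tens_one
  mul_comm := tens_comm

/-- The product of the values of the members of a multiset of formulas. -/
def prod (e : ℕ → A) (Γ : Multiset Fm) : A :=
  letI := tensMonoid A
  (Γ.map (eval e)).prod

theorem prod_add (e : ℕ → A) (Γ Δ : Multiset Fm) :
    prod e (Γ + Δ) = tens (prod e Γ) (prod e Δ) := by
  let := tensMonoid A
  rw [prod, Multiset.map_add, Multiset.prod_add]
  rfl

theorem prod_singleton (e : ℕ → A) (φ : Fm) : prod e {φ} = eval e φ := by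
  let := tensMonoid A
  simp [prod]

theorem prod_pair (e : ℕ → A) (φ ψ : Fm) :
    prod e {φ, ψ} = tens (eval e φ) (eval e ψ) := by
  rw [Multiset.insert_eq_cons, ← Multiset.singleton_add, prod_add, prod_singleton, prod_singleton]

theorem prod_Le_of_le (e : ℕ → A) {Γ Δ : Multiset Fm} (h : Δ ≤ Γ) : Le (prod e Γ) (prod e Δ) := by
  obtain ⟨Θ, rfl⟩ := Multiset.le_iff_exists_add.1 h
  rw [prod_add]
  exact tens_Le_left _ _

theorem eval_foldl_tens (e : ℕ → A) (l : List Fm) (φ : Fm) :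
    eval e (l.foldl Fm.tens φ) = tens (eval e φ) (prod e l) := by
  induction l generalizing φ with
  | nil => exact (tens_one _).symm
  | cons ψ l ih =>
    rw [List.foldl_cons, ih, ← Multiset.cons_coe, ← Multiset.singleton_add, prod_add,
      prod_singleton, ← tens_assoc]
    rfl

theorem eval_bigTens (e : ℕ → A) (l : List Fm) : eval e (Fm.bigTens l) = prod e l := by
  cases l with
  | nil => rfl
  | cons φ l =>
    rw [Fm.bigTens, eval_foldl_tens, ← Multiset.cons_coe, ← Multiset.singleton_add, prod_add,
      prod_singleton]

end MVAlgebra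

/-! ### Soundness -/

theorem MVRule.prod_Le {A : Type u} [MVAlgebra A] (e : ℕ → A) {c : Consecution} (h : MVRule c) :
    CommBCK.Le (MVAlgebra.prod e c.1) (MVAlgebra.prod e c.2) := by
  cases h with
  | base _ h =>
    cases h with
    | ax φ h =>
      dsimp only
      rw [MVAlgebra.prod_singleton, MVAlgebra.eval_lukAx e h]
      exact CommBCK.Le.top _
    | mp φ ψ =>
      dsimp only
      rw [MVAlgebra.prod_pair, MVAlgebra.prod_singleton, MVAlgebra.tens_Le_iff]
      exact CommBCK.le_imp_imp_left _ _
  | tens_elim φ ψ =>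
    dsimp only
    rw [MVAlgebra.prod_singleton, MVAlgebra.prod_pair]
    exact CommBCK.Le.refl _

theorem MVs_step {Γ Γ' : Multiset Fm} (h : MVs.Step Γ Γ') : MV.Step Γ Γ' := by
  obtain ⟨Ψ, Ψ', Θ, h, hΓ, hΓ'⟩ := h
  exact ⟨Ψ, Ψ', Θ, .base _ h, hΓ, hΓ'⟩

theorem MVs_derives {Γ Δ : Multiset Fm} (h : MVs.Derives Γ Δ) : MV.Derives Γ Δ := by
  obtain ⟨Γ', h, hΔ⟩ := h
  exact ⟨Γ', Relation.ReflTransGen.mono (fun _ _ => MVs_step) _ _ h, hΔ⟩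

theorem prod_Le_of_MV_derives {A : Type u} [MVAlgebra A] (e : ℕ → A) {Γ Δ : Multiset Fm}
    (h : MV.Derives Γ Δ) : CommBCK.Le (MVAlgebra.prod e Γ) (MVAlgebra.prod e Δ) := by
  obtain ⟨Γ', h, hΔ⟩ := h
  refine CommBCK.Le.trans ?_ (MVAlgebra.prod_Le_of_le e hΔ)
  clear hΔ
  induction h with
  | refl => exact CommBCK.Le.refl _
  | tail _ h ih =>
    obtain ⟨Ψ, Ψ', Θ, h, rfl, rfl⟩ := h
    refine ih.trans ?_
    rw [MVAlgebra.prod_add, MVAlgebra.prod_add]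
    exact MVAlgebra.tens_Le_tens_left (MVRule.prod_Le e h) _

theorem MVCompanion_of_MV_derives {Γ Δ : Multiset Fm} (h : MV.Derives Γ Δ) :
    MVCompanion.{u} Γ Δ := by
  rintro l l' rfl rfl A _ e
  rw [MVAlgebra.le_iff_Le, MVAlgebra.eval_bigTens, MVAlgebra.eval_bigTens]
  exact prod_Le_of_MV_derives e h

/-! ### The Hilbert calculus -/

/-- Theorems of Łukasiewicz logic. -/
inductive Provable : Fm → Prop
  | ax {φ : Fm} : LukAx φ → Provable φ
  | mp {φ ψ : Fm} : Provable (φ ⇒ ψ) → Provable φ → Provable ψ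

namespace Provable

variable {φ ψ χ : Fm}

theorem trans (h : Provable (φ ⇒ ψ)) (h' : Provable (ψ ⇒ χ)) : Provable (φ ⇒ χ) :=
  mp (mp (ax (.suff φ ψ χ)) h) h'

/-- Weakening gives `φ → ((ψ → φ) → φ)`, and `waj` swaps the roles of `φ` and `ψ`. -/
theorem assertion (φ ψ : Fm) : Provable (φ ⇒ (φ ⇒ ψ) ⇒ ψ) :=
  (ax (.weak _ _)).trans (ax (.waj _ _))

theorem imp_right (h : Provable (ψ ⇒ χ)) (φ : Fm) : Provable ((φ ⇒ ψ) ⇒ φ ⇒ χ) :=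
  (ax (.suff φ ψ χ)).trans (mp (assertion _ _) h)

theorem imp_left (h : Provable (φ ⇒ ψ)) (χ : Fm) : Provable ((ψ ⇒ χ) ⇒ φ ⇒ χ) :=
  mp (ax (.suff φ ψ χ)) h

theorem exchange (φ ψ χ : Fm) : Provable ((φ ⇒ ψ ⇒ χ) ⇒ ψ ⇒ φ ⇒ χ) :=
  (ax (.suff φ (ψ ⇒ χ) χ)).trans ((assertion ψ χ).imp_left _)

theorem imp_of (h : Provable ψ) (φ : Fm) : Provable (φ ⇒ ψ) := mp (ax (.weak _ _)) h

theorem refl (φ : Fm) : Provable (φ ⇒ φ) :=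
  mp (mp (exchange _ _ _) (ax (.weak φ Fm.one))) (ax .one)

theorem one_imp (φ : Fm) : Provable ((Fm.one ⇒ φ) ⇒ φ) := mp (assertion _ _) (ax .one)

/-- Modus ponens consumes its premises, but those of a theorem are theorems themselves and are
generated afresh from axioms, so `Γ` stays intact. -/
theorem reflTransGen (h : Provable φ) (Γ : Multiset Fm) :
    Relation.ReflTransGen MVs.Step Γ (Γ + {φ}) := by
  induction h generalizing Γ with
  | ax h => exact .single ⟨0, _, Γ, .ax _ h, (add_zero Γ).symm, rfl⟩
  | @mp φ ψ _ _ ih ih' =>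
    refine (ih' Γ).trans ((ih (Γ + {φ})).tail ⟨_, _, Γ, .mp φ ψ, ?_, rfl⟩)
    rw [add_assoc]
    rfl

end Provable

/-! ### The Lindenbaum algebra -/

/-- Interderivability of formulas. -/
def fmSetoid : Setoid Fm where
  r φ ψ := Provable (φ ⇒ ψ) ∧ Provable (ψ ⇒ φ)
  iseqv := ⟨fun φ => ⟨.refl φ, .refl φ⟩, fun h => ⟨h.2, h.1⟩,
    fun h h' => ⟨h.1.trans h'.1, h'.2.trans h.2⟩⟩

/-- The Lindenbaum algebra of Łukasiewicz logic in the language without `0`. -/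
def Lindenbaum : Type := Quotient fmSetoid

namespace Lindenbaum

open CommBCK

/-- The class of a formula. -/
def mk (φ : Fm) : Lindenbaum := Quotient.mk fmSetoid φ

theorem mk_eq_mk {φ ψ : Fm} : mk φ = mk ψ ↔ Provable (φ ⇒ ψ) ∧ Provable (ψ ⇒ φ) :=
  Quotient.eq (r := fmSetoid)

theorem mk_eq_one {φ : Fm} : mk φ = mk Fm.one ↔ Provable φ :=
  mk_eq_mk.trans ⟨fun h => .mp h.2 (.ax .one), fun h => ⟨.imp_of (.ax .one) _, .imp_of h _⟩⟩

instance instCommBCK : CommBCK Lindenbaum where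
  imp := Quotient.map₂ Fm.imp fun _ _ h _ _ h' =>
    ⟨(h.2.imp_left _).trans (h'.1.imp_right _), (h.1.imp_left _).trans (h'.2.imp_right _)⟩
  top := mk Fm.one
  top_imp x := by
    induction x using Quotient.inductionOn
    exact mk_eq_mk.2 ⟨.one_imp _, .ax (.weak _ _)⟩
  imp_top x := by
    induction x using Quotient.inductionOn
    exact mk_eq_one.2 (.imp_of (.ax .one) _)
  imp_self x := by
    induction x using Quotient.inductionOn
    exact mk_eq_one.2 (.refl _)
  exchange x y z := by
    induction x using Quotient.inductionOn
    induction y using Quotient.inductionOn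
    induction z using Quotient.inductionOn
    exact mk_eq_mk.2 ⟨.exchange _ _ _, .exchange _ _ _⟩
  imp_imp_comm x y := by
    induction x using Quotient.inductionOn
    induction y using Quotient.inductionOn
    exact mk_eq_mk.2 ⟨.ax (.waj _ _), .ax (.waj _ _)⟩

theorem mk_imp (φ ψ : Fm) : mk (φ ⇒ ψ) = imp (mk φ) (mk ψ) := rfl

theorem mk_Le_mk {φ ψ : Fm} : Le (mk φ) (mk ψ) ↔ Provable (φ ⇒ ψ) := mk_eq_one

theorem mk_tens_imp (φ ψ : Fm) (x : Lindenbaum) :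
    imp (mk (φ ⊙ ψ)) x = imp (mk φ) (imp (mk ψ) x) := by
  induction x using Quotient.inductionOn
  exact mk_eq_mk.2 ⟨.ax (.curry _ _ _), .ax (.uncurry _ _ _)⟩

theorem mk_tens_Le_left (φ ψ : Fm) : Le (mk (φ ⊙ ψ)) (mk φ) := by
  rw [Le, mk_tens_imp]
  exact le_imp _ _

theorem mk_tens_Le_right (φ ψ : Fm) : Le (mk (φ ⊙ ψ)) (mk ψ) := by
  rw [Le, mk_tens_imp, CommBCK.imp_self, imp_top]

theorem mk_conj_Le_left (φ ψ : Fm) : Le (mk (φ ⋏ ψ)) (mk φ) := mk_Le_mk.2 (.ax (.conj_left _ _))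

theorem mk_conj_Le_right (φ ψ : Fm) : Le (mk (φ ⋏ ψ)) (mk ψ) := mk_Le_mk.2 (.ax (.conj_right _ _))

theorem Le_mk_conj {φ ψ : Fm} {x : Lindenbaum} (h : Le x (mk φ)) (h' : Le x (mk ψ)) :
    Le x (mk (φ ⋏ ψ)) := by
  induction x using Quotient.inductionOn
  exact mk_Le_mk.2 (.mp (.mp (.ax (.conj_intro _ _ _)) (mk_Le_mk.1 h)) (mk_Le_mk.1 h'))

theorem mk_disj (φ ψ : Fm) : mk (φ ⋎ ψ) = imp (imp (mk φ) (mk ψ)) (mk ψ) := by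
  refine Le.antisymm ?_ (imp_imp_le (mk_Le_mk.2 (.ax (.disj_left _ _)))
    (mk_Le_mk.2 (.ax (.disj_right _ _))))
  exact mk_Le_mk.2 (.mp (.mp (.ax (.disj_elim _ _ _)) (.assertion _ _)) (.ax (.weak _ _)))

end Lindenbaum

/-! ### Intervals of commutative BCK-algebras are MV-algebras -/

/-- The elements above `a` in a BCK-algebra. -/
structure UpperInterval {H : Type} [CommBCK H] (a : H) : Type u where
  val : H
  base_le : CommBCK.Le a val

namespace UpperInterval

open CommBCK

variable {H : Type} [CommBCK H] {a : H}

theorem val_injective {x y : UpperInterval.{u} a} (h : x.val = y.val) : x = y := by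
  cases x
  cases y
  cases h
  rfl

theorem neg_neg_val (x : UpperInterval.{u} a) : imp (imp x.val a) a = x.val :=
  imp_imp_eq_of_le x.base_le

theorem oplus_comm_val (x y : UpperInterval.{u} a) :
    imp (imp x.val a) y.val = imp (imp y.val a) x.val := by
  conv_lhs => rw [← neg_neg_val y]
  rw [exchange, neg_neg_val]

/-- Double negation `(x → a) → a = x` is exactly where membership in the interval is needed. -/
instance instMVAlgebra : MVAlgebra (UpperInterval.{u} a) where
  oplus x y := ⟨imp (imp x.val a) y.val, y.base_le.trans (le_imp _ _)⟩
  neg x := ⟨imp x.val a, le_imp _ _⟩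
  zero := ⟨a, Le.refl a⟩
  oplus_assoc x y z := by
    apply val_injective
    let xy : UpperInterval.{u} a := ⟨imp (imp x.val a) y.val, y.base_le.trans (le_imp _ _)⟩
    show imp (imp x.val a) (imp (imp y.val a) z.val) = imp (imp xy.val a) z.val
    rw [oplus_comm_val xy z, exchange (imp z.val a), oplus_comm_val z y]
  oplus_comm x y := val_injective (oplus_comm_val x y)
  oplus_zero x := val_injective (neg_neg_val x)
  neg_neg x := val_injective (neg_neg_val x)
  oplus_neg_zero x := by
    apply val_injective
    show imp (imp x.val a) (imp a a) = imp a a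
    rw [CommBCK.imp_self, imp_top]
  lukasiewicz x y := by
    apply val_injective
    let xy : UpperInterval.{u} a := ⟨imp x.val y.val, y.base_le.trans (le_imp _ _)⟩
    let yx : UpperInterval.{u} a := ⟨imp y.val x.val, x.base_le.trans (le_imp _ _)⟩
    show imp (imp (imp (imp (imp (imp x.val a) a) y.val) a) a) y.val =
      imp (imp (imp (imp (imp (imp y.val a) a) x.val) a) a) x.val
    rw [neg_neg_val x, neg_neg_val y]
    show imp (imp (imp xy.val a) a) y.val = imp (imp (imp yx.val a) a) x.val
    rw [neg_neg_val xy, neg_neg_val yx]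
    exact imp_imp_comm _ _

theorem val_one : (MVAlgebra.one : UpperInterval.{u} a).val = top := CommBCK.imp_self a

/-- The implication, and with it the join and the order, does not depend on the chosen bottom `a`;
only the product is truncated at `a`. -/
theorem val_imp (x y : UpperInterval.{u} a) :
    (MVAlgebra.imp x y).val = imp x.val y.val :=
  congrArg (imp · y.val) (neg_neg_val x)

theorem val_sup (x y : UpperInterval.{u} a) :
    (MVAlgebra.sup x y).val = imp (imp x.val y.val) y.val := by
  show (MVAlgebra.imp (MVAlgebra.imp x y) y).val = _
  rw [val_imp, val_imp]

theorem val_tens (x y : UpperInterval.{u} a) :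
    (MVAlgebra.tens x y).val = imp (imp x.val (imp y.val a)) a := by
  show imp (imp (imp (imp x.val a) a) (imp y.val a)) a = _
  rw [neg_neg_val]

theorem val_Le_val {x y : UpperInterval.{u} a} : Le x.val y.val ↔ Le x y := by
  show imp _ _ = top ↔ MVAlgebra.imp _ _ = MVAlgebra.one
  rw [← val_imp, ← val_one (a := a)]
  exact ⟨val_injective, congrArg _⟩

end UpperInterval

/-! ### Completeness -/

/-- The product of all occurrences of variables in a formula. -/
def Fm.varProd : Fm → Fm
  | var n => var n
  | conj φ ψ => tens (varProd φ) (varProd ψ)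
  | disj φ ψ => tens (varProd φ) (varProd ψ)
  | tens φ ψ => tens (varProd φ) (varProd ψ)
  | imp φ ψ => tens (varProd φ) (varProd ψ)
  | one => one

namespace Lindenbaum

open CommBCK

/-- Integrality: the product of two elements lies below their meet, join, product and implication.
-/
theorem mk_varProd_Le (φ : Fm) : Le (mk φ.varProd) (mk φ) := by
  induction φ with
  | var n => exact Le.refl _
  | conj φ ψ h h' =>
    exact Le_mk_conj ((mk_tens_Le_left _ _).trans h) ((mk_tens_Le_right _ _).trans h')
  | disj φ ψ h h' =>
    rw [mk_disj]
    exact ((mk_tens_Le_left _ _).trans h).trans (le_imp_imp_left _ _)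
  | tens φ ψ h h' =>
    show imp (mk (φ.varProd ⊙ ψ.varProd)) _ = top
    rw [mk_tens_imp]
    refine h.trans (le_imp_comm.1 (h'.trans (le_imp_comm.1 ?_)))
    rw [Le, ← mk_tens_imp, CommBCK.imp_self]
  | imp φ ψ h h' => exact ((mk_tens_Le_right _ _).trans h').trans (le_imp (mk ψ) (mk φ))
  | one => exact Le.refl _

/-- The canonical valuation in the interval above `a`. -/
def canonicalVal (a : Lindenbaum) (n : ℕ) : UpperInterval.{u} a :=
  -- The join of the variable with `a`: always in the interval, and the variable's own class when
  -- that lies above `a`.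
  ⟨imp (imp (mk (.var n)) a) a, le_imp_imp_right _ _⟩

theorem val_eval_canonicalVal {a : Lindenbaum} {φ : Fm} (h : Le a (mk φ.varProd)) :
    (MVAlgebra.eval (canonicalVal.{u} a) φ).val = mk φ := by
  induction φ with
  | var n => exact imp_imp_eq_of_le h
  | conj φ ψ ih ih' =>
    have hφ := h.trans (mk_tens_Le_left _ _)
    have hψ := h.trans (mk_tens_Le_right _ _)
    -- The meet of the interval is defined through `a`, so the two meets are compared by their
    -- universal properties; this needs the class of `φ ⋏ ψ` as a point of the interval.
    let m : UpperInterval.{u} a := ⟨mk (φ ⋏ ψ), Le_mk_conj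
      (hφ.trans (mk_varProd_Le φ)) (hψ.trans (mk_varProd_Le ψ))⟩
    refine Le.antisymm (Le_mk_conj ?_ ?_)
      (UpperInterval.val_Le_val (x := m).2 (MVAlgebra.Le_inf ?_ ?_))
    · rw [← ih hφ]
      exact UpperInterval.val_Le_val.2 (MVAlgebra.inf_Le_left _ _)
    · rw [← ih' hψ]
      exact UpperInterval.val_Le_val.2 (MVAlgebra.inf_Le_right _ _)
    · rw [← UpperInterval.val_Le_val, ih hφ]
      exact mk_conj_Le_left φ ψ
    · rw [← UpperInterval.val_Le_val, ih' hψ]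
      exact mk_conj_Le_right φ ψ
  | disj φ ψ ih ih' =>
    rw [MVAlgebra.eval, UpperInterval.val_sup, ih (h.trans (mk_tens_Le_left _ _)),
      ih' (h.trans (mk_tens_Le_right _ _)), mk_disj]
  | tens φ ψ ih ih' =>
    rw [MVAlgebra.eval, UpperInterval.val_tens, ih (h.trans (mk_tens_Le_left _ _)),
      ih' (h.trans (mk_tens_Le_right _ _)), ← mk_tens_imp]
    exact imp_imp_eq_of_le (h.trans (mk_varProd_Le (φ ⊙ ψ)))
  | imp φ ψ ih ih' =>
    rw [MVAlgebra.eval, UpperInterval.val_imp, ih (h.trans (mk_tens_Le_left _ _)),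
      ih' (h.trans (mk_tens_Le_right _ _)), mk_imp]
  | one => exact UpperInterval.val_one

end Lindenbaum

theorem provable_of_MVValidLe {φ ψ : Fm} (h : MVValidLe.{u} φ ψ) : Provable (φ ⇒ ψ) := by
  let a := Lindenbaum.mk (φ.varProd ⊙ ψ.varProd)
  have h := MVAlgebra.le_iff_Le.1 (h (UpperInterval.{u} a) (Lindenbaum.canonicalVal a))
  rwa [← UpperInterval.val_Le_val,
    Lindenbaum.val_eval_canonicalVal (Lindenbaum.mk_tens_Le_left _ _),
    Lindenbaum.val_eval_canonicalVal (Lindenbaum.mk_tens_Le_right _ _),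
    Lindenbaum.mk_Le_mk] at h

theorem reflTransGen_of_provable_imp {φ ψ : Fm} (h : Provable (φ ⇒ ψ)) (Γ : Multiset Fm) :
    Relation.ReflTransGen MVs.Step (Γ + {φ}) (Γ + {ψ}) := by
  refine (h.reflTransGen _).tail ⟨_, _, Γ, .mp φ ψ, ?_, rfl⟩
  rw [add_assoc]
  rfl

theorem reflTransGen_of_provable_foldl_imp {φ ψ : Fm} (l : List Fm)
    (h : Provable (l.foldl Fm.tens φ ⇒ ψ)) :
    Relation.ReflTransGen MVs.Step ((l : Multiset Fm) + {φ}) {ψ} := by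
  -- Reversing the list puts the outermost factor `χ` at its head. Currying moves `χ` into the
  -- conclusion; the induction derives `χ ⇒ ψ` with `χ` idle in the context, and modus ponens then
  -- spends it.
  suffices H : ∀ (l : List Fm) (ψ : Fm), Provable (l.foldr (fun χ ρ => ρ ⊙ χ) φ ⇒ ψ) →
      Relation.ReflTransGen MVs.Step ((l : Multiset Fm) + {φ}) {ψ} by
    rw [← Multiset.coe_reverse]
    refine H _ _ ?_
    rwa [List.foldr_reverse]
  clear h ψ l
  intro l
  induction l with
  | nil =>
    intro ψ h
    simpa using reflTransGen_of_provable_imp h 0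
  | cons χ l ih =>
    intro ψ h
    have h' := ih _ (.mp (.ax (.curry _ _ _)) h)
    have lift : ∀ Γ Γ' : Multiset Fm, MVs.Step Γ Γ' → MVs.Step ({χ} + Γ) ({χ} + Γ') := by
      rintro _ _ ⟨Ψ, Ψ', Θ, h, rfl, rfl⟩
      exact ⟨Ψ, Ψ', {χ} + Θ, h, (add_assoc _ _ _).symm, (add_assoc _ _ _).symm⟩
    have h'' := Relation.ReflTransGen.lift ({χ} + ·) lift _ _ h'
    rw [← Multiset.cons_coe, ← Multiset.singleton_add, add_assoc]
    exact h''.tail ⟨_, _, 0, .mp χ ψ, (zero_add _).symm, (zero_add _).symm⟩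

theorem MVs_derives_of_MVValidLe {l : List Fm} {φ : Fm} (h : MVValidLe.{u} (Fm.bigTens l) φ) :
    MVs.Derives l {φ} := by
  have h := provable_of_MVValidLe h
  cases l with
  | nil => exact ⟨_, (Provable.mp h (.ax .one)).reflTransGen 0, by simp⟩
  | cons ψ l =>
    refine ⟨_, ?_, le_refl _⟩
    rw [← Multiset.cons_coe, ← Multiset.singleton_add, add_comm]
    exact reflTransGen_of_provable_foldl_imp l h

/-- The product nests to the left, so the last factors split off first, and `φ ⊙ ψ` is the last to
be split. -/
theorem reflTransGen_foldl_tens (l : List Fm) (φ : Fm) (Θ : Multiset Fm) :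
    Relation.ReflTransGen MV.Step (Θ + {l.foldl Fm.tens φ}) (Θ + ({φ} + (l : Multiset Fm))) := by
  induction l generalizing φ with
  | nil => exact .refl
  | cons ψ l ih =>
    refine (ih (φ ⊙ ψ)).tail ⟨_, _, Θ + l, .tens_elim φ ψ, ?_, ?_⟩
    · rw [add_assoc, add_comm {φ ⊙ ψ}]
    · rw [← Multiset.cons_coe, ← Multiset.singleton_add, Multiset.insert_eq_cons,
        ← Multiset.singleton_add, add_assoc Θ, add_comm (l : Multiset Fm),
        add_assoc ({φ} : Multiset Fm)]

theorem MV_derives_of_derives_bigTens {Γ : Multiset Fm} {l : List Fm}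
    (h : MV.Derives Γ {Fm.bigTens l}) : MV.Derives Γ l := by
  obtain ⟨Γ', h, hΓ'⟩ := h
  obtain ⟨Θ, rfl⟩ := Multiset.le_iff_exists_add.1 hΓ'
  cases l with
  | nil => exact ⟨_, h, Multiset.zero_le _⟩
  | cons φ l =>
    rw [add_comm] at h
    refine ⟨_, h.trans (reflTransGen_foldl_tens l φ Θ), ?_⟩
    rw [Multiset.singleton_add, Multiset.cons_coe]
    exact Multiset.le_add_left _ _

theorem MVs_derives_of_MVCompanion {Γ : Multiset Fm} {φ : Fm} (h : MVCompanion.{u} Γ {φ}) :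
    MVs.Derives Γ {φ} := by
  rw [← Multiset.coe_toList Γ]
  exact MVs_derives_of_MVValidLe (h _ [φ] (Multiset.coe_toList Γ) rfl)

theorem MV_derives_of_MVCompanion {Γ Δ : Multiset Fm} (h : MVCompanion.{u} Γ Δ) :
    MV.Derives Γ Δ := by
  rw [← Multiset.coe_toList Γ, ← Multiset.coe_toList Δ]
  exact MV_derives_of_derives_bigTens (MVs_derives (MVs_derives_of_MVValidLe
    (h _ _ (Multiset.coe_toList Γ) (Multiset.coe_toList Δ))))

end MultisetLogic

theorem mainTheorem6 :
    (∀ (Γ : Multiset MultisetLogic.Fm) (φ : MultisetLogic.Fm),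
      MultisetLogic.MVs.Derives Γ {φ} ↔ MultisetLogic.MVCompanion.{u} Γ {φ}) ∧
    (∀ Γ Δ : Multiset MultisetLogic.Fm,
      MultisetLogic.MV.Derives Γ Δ ↔ MultisetLogic.MVCompanion.{u} Γ Δ) := by
  exact ⟨fun _ _ => ⟨fun h => MultisetLogic.MVCompanion_of_MV_derives (MultisetLogic.MVs_derives h),
      MultisetLogic.MVs_derives_of_MVCompanion⟩,
    fun _ _ => ⟨MultisetLogic.MVCompanion_of_MV_derives,
      MultisetLogic.MV_derives_of_MVCompanion⟩⟩
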